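/- For a nonsingular binary matrix $K\in GL(\ell,\mathbb F_2)$ (a kernel), $i\in\{1,\dots,\ell\}$ and $z\in(0,1)$, let $f_{K,i}(z)$ be the erasure probability of the $i$-th bit-channel of $K$ over the binary erasure channel $W=\mathrm{BEC}(z)$, that is, of the channel with input $u_i\in\mathbb F_2$, output $(y,v)\in\{0,1,?\}^{\ell}\times\mathbb F_2^{\,i-1}$ and transition probabilities $$W_i(y,v\mid u_i)=\frac1{2^{\ell-1}}\sum_{u'\in\mathbb F_2^{\,\ell-i}}W^{\ell}\bigl(y\mid (v,u_i,u')K\bigr),$$ where $W^\ell$ denotes $\ell$ independent uses of $W$. (Every output of this channel either determines $u_i$ or is equally likely under both values of $u_i$; the erasure probability is the probability of an output of the second kind.) For $\alpha>0$ put $g_\alpha(z)=z^\alpha(1-z)^\alpha$, $$\lambda_{\alpha,K}(z)=\frac{\frac1\ell\sum_{i=1}^{\ell}g_\alpha\bigl(f_{K,i}(z)\bigr)}{g_\alpha(z)}\quad(0<z<1),\qquad \lambda^*_{\alpha,K}=\sup_{z\in(0,1)}\lambda_{\alpha,K}(z).$$ **Theorem.** Fix $\alpha\in(0,1/16)$.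 There exists $\ell_1(\alpha)$ such that, for every integer $\ell>\ell_1(\alpha)$, if $K$ is chosen uniformly at random from $GL(\ell,\mathbb F_2)$, then $$\mathbb P\Bigl\{\log_\ell\bigl(\lambda^*_{\alpha,K}\bigr)\le-\tfrac12+5\alpha\Bigr\}\ \ge\ 1-\frac2\ell ,$$ i.e. with probability at least $1-2/\ell$ the supremum $\lambda^*_{\alpha,K}$ is finite and at most $\ell^{-1/2+5\alpha}$. -/

import Mathlib

open scoped MatrixGroups

noncomputable section

namespace PolarKernel

/-- The binary erasure channel with erasure probability `z`: `bec z x y` is the probability of the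
output `y` given the input bit `x`. The output `none` is the erasure symbol. -/
def bec (z : ℝ) (x : ZMod 2) : Option (ZMod 2) → ℝ
  | none => z
  | some y => if y = x then 1 - z else 0

/-- `n` independent uses of the channel `W`. -/
def channelPow {n : ℕ} {Y : Type*} (W : ZMod 2 → Y → ℝ) (x : Fin n → ZMod 2) (y : Fin n → Y) : ℝ :=
  ∏ j, W (x j) (y j)

/-- The `i`-th bit-channel of the kernel `K` over the channel `W` (bits are indexed from `0`).
Its input is the bit `b = u i`; its output is a pair `(y, v)`, where `y` is the channel output and
`v` is the vector of the bits that precede position `i`. The information vector `u` is encoded as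
the row vector `u K`; the sum is over all `u` whose initial segment is `(v, b)`. -/
def bitChannel {n : ℕ} {Y : Type*} (W : ZMod 2 → Y → ℝ) (K : Matrix (Fin n) (Fin n) (ZMod 2))
    (i : Fin n) (b : ZMod 2) (o : (Fin n → Y) × ({j : Fin n // j < i} → ZMod 2)) : ℝ :=
  1 / 2 ^ (n - 1) *
    ∑ u : Fin n → ZMod 2 with (∀ j : {j : Fin n // j < i}, u j = o.2 j) ∧ u i = b,
      channelPow W (Matrix.vecMul u K) o.1

open Classical in
/-- The erasure probability of a binary-input channel each of whose outputs either reveals the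
input or carries no information about it: the probability of the outputs that are equally likely
under both inputs. (Conditioning on the input `0` or on the input `1` gives the same number.) -/
def erasureProb {O : Type*} [Fintype O] (V : ZMod 2 → O → ℝ) : ℝ :=
  ∑ o : O with V 0 o = V 1 o, V 0 o

/-- Bit-channels of the binary erasure channel are erasure channels: every output that is possible
under both inputs is equally likely under both. -/
theorem bitChannel_bec_eq_or {n : ℕ} (z : ℝ) (K : Matrix (Fin n) (Fin n) (ZMod 2)) (i : Fin n)
    (o : (Fin n → Option (ZMod 2)) × ({j : Fin n // j < i} → ZMod 2)) :
    bitChannel (bec z) K i 0 o = bitChannel (bec z) K i 1 o ∨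
      bitChannel (bec z) K i 0 o = 0 ∨ bitChannel (bec z) K i 1 o = 0 := by
  by_contra! h
  obtain ⟨h, h0, h1⟩ := h
  obtain ⟨u0, hu0, hp0⟩ := Finset.exists_ne_zero_of_sum_ne_zero (right_ne_zero_of_mul h0)
  obtain ⟨u1, hu1, hp1⟩ := Finset.exists_ne_zero_of_sum_ne_zero (right_ne_zero_of_mul h1)
  simp only [Finset.mem_filter, Finset.mem_univ, true_and] at hu0 hu1
  apply h
  unfold bitChannel
  congr 1
  refine Finset.sum_bij' (fun u _ => u + (u1 - u0)) (fun u _ => u - (u1 - u0)) ?_ ?_ ?_ ?_ ?_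
  · intro u hu
    simp only [Finset.mem_filter, Finset.mem_univ, true_and] at hu ⊢
    refine ⟨fun j => ?_, ?_⟩
    · simp [hu.1 j, hu0.1 j, hu1.1 j]
    · simp [hu.2, hu0.2, hu1.2]
  · intro u hu
    simp only [Finset.mem_filter, Finset.mem_univ, true_and] at hu ⊢
    refine ⟨fun j => ?_, ?_⟩
    · simp [hu.1 j, hu0.1 j, hu1.1 j]
    · simp [hu.2, hu0.2, hu1.2]
  · intro u _
    simp
  · intro u _
    simp
  · intro u _
    refine Finset.prod_congr rfl fun j _ => ?_
    have e0 := Finset.prod_ne_zero_iff.1 hp0 j (Finset.mem_univ j)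
    have e1 := Finset.prod_ne_zero_iff.1 hp1 j (Finset.mem_univ j)
    rw [Matrix.add_vecMul, Matrix.sub_vecMul]
    cases hy : o.1 j with
    | none => simp [bec]
    | some c =>
      rw [hy] at e0 e1
      have c0 : c = Matrix.vecMul u0 K j := by
        by_contra hc
        simp [bec, hc] at e0
      have c1 : c = Matrix.vecMul u1 K j := by
        by_contra hc
        simp [bec, hc] at e1
      simp [← c0, ← c1]

/-- The polarization behavior `f_{K,i}(z)` of a nonsingular binary kernel `K`: the erasure
probability of its `i`-th bit-channel over the binary erasure channel with erasure
probability `z`. -/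
def f {n : ℕ} (K : GL (Fin n) (ZMod 2)) (i : Fin n) (z : ℝ) : ℝ :=
  erasureProb (bitChannel (bec z) (K : Matrix (Fin n) (Fin n) (ZMod 2)) i)

/-- `g_α(z) = z^α (1 - z)^α`. -/
def g (α z : ℝ) : ℝ := z ^ α * (1 - z) ^ α

/-- `λ_{α,K}(z)`. -/
def lam {n : ℕ} (α : ℝ) (K : GL (Fin n) (ZMod 2)) (z : ℝ) : ℝ :=
  (1 / (n : ℝ) * ∑ i : Fin n, g α (f K i z)) / g α z

/-- `λ*_{α,K}`, the supremum of `λ_{α,K}` over the open unit interval (meaningful when `λ_{α,K}` is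
bounded there). -/
def lamSup {n : ℕ} (α : ℝ) (K : GL (Fin n) (ZMod 2)) : ℝ :=
  sSup (lam α K '' Set.Ioo (0 : ℝ) 1)

/-- The probability of the event `S` under the uniform distribution on the finite set `Ω`. -/
def uniformProb {Ω : Type*} [Finite Ω] (S : Set Ω) : ℝ :=
  (S.ncard : ℝ) / (Nat.card Ω : ℝ)

end PolarKernel

end

/-! Over the erasure channel, `f K i z` is the probability that a random set `E`, containing each
position independently with probability `z`, leaves bit `i` undetermined: some `u` with zeros before
`i` and `u i = 1` has `u K` supported in `E` (`f_eq_sum_finset`).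

For fixed `E` and random `K`, a nonzero `u` is sent to a uniform nonzero vector, so a union bound
over such `u` makes bit `i` undetermined with probability at most `2 ^ (#E - i - 1)`. Dually, a
determined bit has a parity check supported off `E`, and the same argument for `K⁻¹` gives at most
`2 ^ (i - #E)`. Hence the transition is sharp at `#E ≈ i`. Markov's inequality, applied once to the
sum of the `2 n (n + 1)` normalized counts, loses a factor `n ^ 4` and yields `SharpCounts` outside
probability `2 (n + 1) / n ^ 3`.

The rest is deterministic. Since `#E` concentrates around `n z` at scale `√n`, bits with `|i - n z|
> n ^ (1/2 + α)` have `f` extremely close to `0` or `1`. When `1 / n ^ 2 ≤ z ≤ 1 / 2`, about `2 n ^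
(1/2 + α)` bits remain, each with `g ≤ 1`, while `g α z ≥ n ^ (-2 α) / 2`; constants cost another `n
^ α`. When `z ≤ 1 / n ^ 2`, all bits satisfy `f ≤ 3 n z`, and those with `i ≥ √n` are undetermined
by no small pattern, so `f` is of order `(n z) ^ k` there. The case `z ≥ 1 / 2` follows by
exchanging erased and unerased positions. -/

noncomputable section

/-! ### Bit-channel erasure probability as a sum over erasure patterns. -/

namespace PolarKernel

open Finset Matrix

variable {n : ℕ}

/-- The bit `i` is not determined by the preceding bits and the channel outputs outside the set `E`
of erased positions. -/
def Undetermined (K : Matrix (Fin n) (Fin n) (ZMod 2)) (i : Fin n) (E : Finset (Fin n)) : Prop :=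
  ∃ u : Fin n → ZMod 2, (∀ j < i, u j = 0) ∧ u i = 1 ∧ ∀ j ∉ E, vecMul u K j = 0

open Classical in
/-- The output received when `x` is sent and the positions in `E` are erased. -/
def eraseAt (x : Fin n → ZMod 2) (E : Finset (Fin n)) (j : Fin n) : Option (ZMod 2) :=
  if j ∈ E then none else some (x j)

lemma eraseAt_injective (x : Fin n → ZMod 2) : Function.Injective (eraseAt x) := by
  intro E F h
  ext j
  have := congrFun h j
  by_cases hE : j ∈ E <;> by_cases hF : j ∈ F <;> simp_all [eraseAt]

lemma channelPow_bec_eraseAt (z : ℝ) (x x' : Fin n → ZMod 2) (E : Finset (Fin n)) :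
    channelPow (bec z) x' (eraseAt x E) =
      if ∀ j ∉ E, x j = x' j then z ^ #E * (1 - z) ^ (n - #E) else 0 := by
  classical
  split_ifs with h
  · have : ∀ j, bec z (x' j) (eraseAt x E j) = if j ∈ E then z else 1 - z := by
      intro j
      by_cases hj : j ∈ E
      · simp [eraseAt, hj, bec]
      · simp [eraseAt, hj, bec, h j hj]
    simp only [channelPow, this]
    rw [Finset.prod_ite]
    simp [filter_not, card_sdiff]
  · push Not at h
    obtain ⟨j, hj, hne⟩ := h
    exact prod_eq_zero (mem_univ j) (by simp [eraseAt, hj, bec, hne])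

lemma exists_eraseAt_of_channelPow_ne_zero {z : ℝ} {x : Fin n → ZMod 2}
    {y : Fin n → Option (ZMod 2)} (h : channelPow (bec z) x y ≠ 0) : ∃ E, eraseAt x E = y := by
  classical
  refine ⟨univ.filter fun j => y j = none, funext fun j => ?_⟩
  have hj := prod_ne_zero_iff.1 h j (mem_univ j)
  cases hy : y j with
  | none => simp [eraseAt, hy]
  | some c =>
    rw [hy] at hj
    have : c = x j := by
      by_contra hc
      simp [bec, hc] at hj
    simp [eraseAt, hy, this]

lemma channelPow_bec_nonneg {z : ℝ} (hz : z ∈ Set.Ioo (0 : ℝ) 1) (x : Fin n → ZMod 2)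
    (y : Fin n → Option (ZMod 2)) : 0 ≤ channelPow (bec z) x y := by
  refine prod_nonneg fun j _ => ?_
  have := hz.1
  have := hz.2
  cases y j with
  | none => simp [bec]; linarith
  | some c => simp only [bec]; split_ifs <;> linarith

lemma sum_channelPow_bec_mul (z : ℝ) (x : Fin n → ZMod 2)
    (F : (Fin n → Option (ZMod 2)) → ℝ) :
    ∑ y, channelPow (bec z) x y * F y =
      ∑ E : Finset (Fin n), z ^ #E * (1 - z) ^ (n - #E) * F (eraseAt x E) := by
  symm
  refine sum_of_injOn (eraseAt x) (eraseAt_injective x).injOn (fun _ _ => by simp) ?_ ?_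
  · intro y _ hy
    by_contra h
    obtain ⟨E, hE⟩ := exists_eraseAt_of_channelPow_ne_zero (left_ne_zero_of_mul h)
    exact hy ⟨E, by simp, hE⟩
  · intro E _
    simp [channelPow_bec_eraseAt]

lemma bitChannel_ne_zero_iff {z : ℝ} (hz : z ∈ Set.Ioo (0 : ℝ) 1)
    (K : Matrix (Fin n) (Fin n) (ZMod 2)) (i : Fin n) (b : ZMod 2)
    (o : (Fin n → Option (ZMod 2)) × ({j : Fin n // j < i} → ZMod 2)) :
    bitChannel (bec z) K i b o ≠ 0 ↔
      ∃ u : Fin n → ZMod 2, (∀ j : {j : Fin n // j < i}, u j = o.2 j) ∧ u i = b ∧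
        channelPow (bec z) (vecMul u K) o.1 ≠ 0 := by
  unfold bitChannel
  rw [mul_ne_zero_iff, Ne, Ne, sum_eq_zero_iff_of_nonneg
    (fun u _ => channelPow_bec_nonneg hz _ _)]
  simp

/-- Input `0` explains the output through `u` itself, so by `bitChannel_bec_eq_or` equality holds
exactly when input `1` also explains it. The difference of two explanations is a witness of
`Undetermined`. -/
lemma bitChannel_eq_iff_undetermined {z : ℝ} (hz : z ∈ Set.Ioo (0 : ℝ) 1)
    (K : Matrix (Fin n) (Fin n) (ZMod 2)) (i : Fin n) (u : Fin n → ZMod 2) (hu : u i = 0)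
    (E : Finset (Fin n)) :
    bitChannel (bec z) K i 0 (eraseAt (vecMul u K) E, fun j => u j) =
      bitChannel (bec z) K i 1 (eraseAt (vecMul u K) E, fun j => u j) ↔ Undetermined K i E := by
  have hw : z ^ #E * (1 - z) ^ (n - #E) ≠ 0 :=
    mul_ne_zero (pow_ne_zero _ hz.1.ne') (pow_ne_zero _ (sub_ne_zero.2 hz.2.ne'))
  have h0 : bitChannel (bec z) K i 0 (eraseAt (vecMul u K) E, fun j => u j) ≠ 0 :=
    (bitChannel_ne_zero_iff hz ..).2 ⟨u, fun _ => rfl, hu, by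
      simpa [channelPow_bec_eraseAt] using hw⟩
  have h1 : bitChannel (bec z) K i 1 (eraseAt (vecMul u K) E, fun j => u j) ≠ 0 ↔
      Undetermined K i E := by
    rw [bitChannel_ne_zero_iff hz]
    constructor
    · rintro ⟨v, hv, hvi, hc⟩
      refine ⟨v - u, fun j hj => ?_, by simp [hu, hvi], fun j hj => ?_⟩
      · simpa [sub_eq_zero] using hv ⟨j, hj⟩
      · rw [channelPow_bec_eraseAt] at hc
        have := (ite_ne_right_iff.1 hc).1 j hj
        simp [sub_vecMul, this]
    · rintro ⟨w, hw0, hwi, hwE⟩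
      refine ⟨u + w, fun j => by simp [hw0 j j.2], by simp [hu, hwi], ?_⟩
      rw [channelPow_bec_eraseAt, if_pos]
      · exact hw
      · intro j hj
        simp [add_vecMul, hwE j hj]
  rw [← h1]
  constructor
  · intro h
    rwa [← h]
  · intro h
    rcases bitChannel_bec_eq_or z K i (eraseAt (vecMul u K) E, fun j => u j) with h' | h' | h'
    · exact h'
    · exact absurd h' h0
    · exact absurd h' h

lemma card_filter_apply_eq (i : Fin n) (b : ZMod 2) :
    #{u : Fin n → ZMod 2 | u i = b} = 2 ^ (n - 1) := by
  have := Fintype.card_filter_piFinset_const (univ : Finset (ZMod 2)) i b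
  simpa [Fintype.piFinset_univ] using this

open Classical in
/-- The erasure probability of a bit-channel, as a sum over the patterns of erasures. -/
theorem f_eq_sum_finset (K : GL (Fin n) (ZMod 2)) (i : Fin n) {z : ℝ}
    (hz : z ∈ Set.Ioo (0 : ℝ) 1) :
    f K i z = ∑ E : Finset (Fin n), if Undetermined K.1 i E then
      z ^ #E * (1 - z) ^ (n - #E) else 0 := by
  set V := bitChannel (bec z) K.1 i with hV
  have key : ∀ u : Fin n → ZMod 2, u i = 0 →
      ∑ y, channelPow (bec z) (vecMul u K.1) y *
        (if V 0 (y, fun j => u j) = V 1 (y, fun j => u j) then (1 : ℝ) else 0) =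
      ∑ E : Finset (Fin n), if Undetermined K.1 i E then
        z ^ #E * (1 - z) ^ (n - #E) else 0 := by
    intro u hu
    rw [sum_channelPow_bec_mul]
    refine sum_congr rfl fun E _ => ?_
    simp only [hV, bitChannel_eq_iff_undetermined hz K.1 i u hu E]
    simp
  -- Condition on input `0` and average over the words `u` with `u i = 0`, grouped by their prefix.
  -- By `key` the inner sum does not depend on `u`.
  have step : f K i z = 1 / 2 ^ (n - 1) * ∑ u : Fin n → ZMod 2 with u i = 0,
      ∑ y, channelPow (bec z) (vecMul u K.1) y *
        (if V 0 (y, fun j => u j) = V 1 (y, fun j => u j) then (1 : ℝ) else 0) := by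
    unfold f erasureProb
    rw [sum_filter, Fintype.sum_prod_type, sum_comm (s := univ.filter _), mul_sum]
    refine sum_congr rfl fun y _ => ?_
    rw [sum_filter, ← Finset.sum_fiberwise (s := univ)
      (g := fun (u : Fin n → ZMod 2) (j : {j : Fin n // j < i}) => u j), mul_sum]
    refine sum_congr rfl fun v _ => ?_
    rw [← hV]
    split_ifs with h
    · rw [hV, bitChannel, sum_filter, sum_filter]
      congr 1
      refine sum_congr rfl fun u _ => ?_
      by_cases huv : (fun j : {j : Fin n // j < i} => u j) = v
      · subst huv
        rw [hV] at h
        by_cases hu : u i = 0 <;> simp [hu, h]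
      · have : ¬ ∀ j : {j : Fin n // j < i}, u j = v j := fun h' => huv (funext h')
        rw [if_neg huv, if_neg fun h' => this h'.1]
    · symm
      apply mul_eq_zero_of_right
      refine sum_eq_zero fun u hu => ?_
      have huv := (mem_filter.1 hu).2
      subst huv
      simp [h]
  rw [step, sum_congr rfl fun u hu => key u (mem_filter.1 hu).2, sum_const, card_filter_apply_eq]
  simp

end PolarKernel

/-! ### First-moment bounds for a random kernel. -/

namespace PolarKernel

open Finset Matrix

variable {n : ℕ}

/-- The isomorphism between the lines through `v` and `w` extends to an automorphism of the whole
space. -/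
lemma exists_GL_mulVec_eq {F : Type*} [Field F] {v w : Fin n → F} (hv : v ≠ 0) (hw : w ≠ 0) :
    ∃ A : GL (Fin n) F, A.1 *ᵥ v = w := by
  obtain ⟨g, hg⟩ := Submodule.exists_linearEquiv_restrict_eq
    ((LinearEquiv.toSpanNonzeroSingleton F _ v hv).symm ≪≫ₗ
      LinearEquiv.toSpanNonzeroSingleton F _ w hw)
  refine ⟨GeneralLinearGroup.toLin.symm (LinearMap.GeneralLinearGroup.ofLinearEquiv g), ?_⟩
  have h1 := hg ⟨v, Submodule.mem_span_singleton_self v⟩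
  have h2 : (LinearEquiv.toSpanNonzeroSingleton F _ v hv).symm
      ⟨v, Submodule.mem_span_singleton_self v⟩ = 1 := by
    rw [LinearEquiv.symm_apply_eq]
    ext
    simp
  rw [LinearEquiv.trans_apply, h2] at h1
  simp only [LinearEquiv.toSpanNonzeroSingleton_apply, one_smul] at h1
  have h3 : (GeneralLinearGroup.toLin.symm (LinearMap.GeneralLinearGroup.ofLinearEquiv g)).1 =
      LinearMap.toMatrix' (g : (Fin n → F) →ₗ[F] (Fin n → F)) := rfl
  rw [h3, LinearMap.toMatrix'_mulVec]
  exact h1.symm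

lemma exists_GL_vecMul_eq {F : Type*} [Field F] {v w : Fin n → F} (hv : v ≠ 0) (hw : w ≠ 0) :
    ∃ A : GL (Fin n) F, v ᵥ* A.1 = w := by
  obtain ⟨A, hA⟩ := exists_GL_mulVec_eq hv hw
  have hu : IsUnit A.1ᵀ := (isUnit_transpose A.1).2 A.isUnit
  exact ⟨hu.unit, by rw [IsUnit.unit_spec, vecMul_transpose, hA]⟩

/-- A random element whose law is uniform on the nonzero elements of `V` lies in a set containing
`0` with probability at most the density of this set. -/
lemma card_filter_mem_mul_card_le {Ω V : Type*} [Fintype Ω] [Fintype V] [DecidableEq V] [Zero V]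
    (X : Ω → V) (hX : ∀ ω, X ω ≠ 0)
    (hfib : ∀ v w, v ≠ 0 → w ≠ 0 → #{ω | X ω = v} ≤ #{ω | X ω = w}) (A : Finset V)
    (hA : 0 ∈ A) : #{ω | X ω ∈ A} * Fintype.card V ≤ Fintype.card Ω * #A := by
  rcases isEmpty_or_nonempty Ω with hΩ | ⟨⟨ω₀⟩⟩
  · simp
  set c := #{ω | X ω = X ω₀} with hc
  -- All nonzero values have fibres of the same size `c`, and the value `0` is never taken.
  have key : ∀ B : Finset V, 0 ∈ B → #{ω | X ω ∈ B} = (#B - 1) * c := by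
    intro B hB
    rw [card_eq_sum_card_fiberwise (f := X) (t := B.erase 0)
      (fun ω hω => mem_coe.2 (mem_erase.2 ⟨hX ω, (mem_filter.1 hω).2⟩)), ← card_erase_of_mem hB,
      ← smul_eq_mul, ← sum_const]
    refine sum_congr rfl fun v hv => ?_
    have hv' := mem_erase.1 hv
    rw [filter_filter]
    have : (univ.filter fun ω => X ω ∈ B ∧ X ω = v) = univ.filter fun ω => X ω = v := by
      ext ω
      simp only [mem_filter, mem_univ, true_and, and_iff_right_iff_imp]
      rintro rfl
      exact hv'.2
    rw [this]
    exact le_antisymm (hfib _ _ hv'.1 (hX _)) (hfib _ _ (hX _) hv'.1)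
  have h1 := key A hA
  have h2 := key univ (mem_univ _)
  simp only [mem_univ, filter_true, card_univ] at h2
  rw [h1, h2]
  have hle : #A ≤ Fintype.card V := card_le_univ A
  have hpos : 0 < #A := card_pos.2 ⟨0, hA⟩
  obtain ⟨a, ha⟩ := Nat.exists_eq_add_of_lt hpos
  obtain ⟨b, hb⟩ := Nat.exists_eq_add_of_lt (hpos.trans_le hle)
  have hab : a ≤ b := by omega
  rw [ha, hb]
  simp only [zero_add, Nat.add_sub_cancel]
  -- This is `a / b ≤ (a + 1) / (b + 1)` for `a ≤ b`, cleared of denominators.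
  nlinarith [Nat.mul_le_mul_left c hab]

lemma card_filter_forall_notMem_eq_zero (E : Finset (Fin n)) :
    #{x : Fin n → ZMod 2 | ∀ j ∉ E, x j = 0} = 2 ^ #E := by
  have : (univ.filter fun x : Fin n → ZMod 2 => ∀ j ∉ E, x j = 0) =
      Fintype.piFinset fun j => if j ∈ E then univ else {0} := by
    ext x
    simp only [mem_filter, mem_univ, true_and, Fintype.mem_piFinset]
    refine forall_congr' fun j => ?_
    by_cases hj : j ∈ E <;> simp [hj]
  rw [this, Fintype.card_piFinset]
  simp [apply_ite]

lemma card_filter_lt_eq_zero (i : Fin n) :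
    #{u : Fin n → ZMod 2 | (∀ j < i, u j = 0) ∧ u i = 1} = 2 ^ (n - 1 - i) := by
  have : (univ.filter fun u : Fin n → ZMod 2 => (∀ j < i, u j = 0) ∧ u i = 1) =
      Fintype.piFinset fun j => if j < i then {0} else if j = i then {1} else univ := by
    ext x
    simp only [mem_filter, mem_univ, true_and, Fintype.mem_piFinset]
    constructor
    · rintro ⟨h1, h2⟩ j
      split_ifs with h h'
      · simp [h1 j h]
      · simp [h', h2]
      · simp
    · intro h
      refine ⟨fun j hj => by simpa [hj] using h j, by simpa using h i⟩
  rw [this, Fintype.card_piFinset, ← Fin.card_Ioi, ← prod_const, ← prod_subset (subset_univ (Ioi i))]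
  · refine prod_congr rfl fun j hj => ?_
    have : i < j := by simpa using hj
    simp [this.not_gt, this.ne']
  · intro j _ hj
    have : j ≤ i := by simpa using hj
    rcases this.lt_or_eq with h | h <;> simp [h]

lemma card_filter_gt_eq_zero (i : Fin n) :
    #{u : Fin n → ZMod 2 | (∀ j, i < j → u j = 0) ∧ u i = 1} = 2 ^ (i : ℕ) := by
  have : (univ.filter fun u : Fin n → ZMod 2 => (∀ j, i < j → u j = 0) ∧ u i = 1) =
      Fintype.piFinset fun j => if i < j then {0} else if j = i then {1} else univ := by
    ext x
    simp only [mem_filter, mem_univ, true_and, Fintype.mem_piFinset]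
    constructor
    · rintro ⟨h1, h2⟩ j
      split_ifs with h h'
      · simp [h1 j h]
      · simp [h', h2]
      · simp
    · intro h
      refine ⟨fun j hj => by simpa [hj] using h j, by simpa using h i⟩
  rw [this, Fintype.card_piFinset, ← Fin.card_Iio, ← prod_const, ← prod_subset (subset_univ (Iio i))]
  · refine prod_congr rfl fun j hj => ?_
    have : j < i := by simpa using hj
    simp [this.not_gt, this.ne]
  · intro j _ hj
    have : i ≤ j := by simpa using hj
    rcases this.lt_or_eq with h | h <;> simp [h]

lemma vecMul_GL_ne_zero (K : GL (Fin n) (ZMod 2)) {u : Fin n → ZMod 2} (hu : u ≠ 0) :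
    u ᵥ* K.1 ≠ 0 := by
  intro h
  apply hu
  have := congrArg (fun x => x ᵥ* (K⁻¹).1) h
  simpa [vecMul_vecMul, ← Units.val_mul] using this

lemma mulVec_GL_ne_zero (K : GL (Fin n) (ZMod 2)) {u : Fin n → ZMod 2} (hu : u ≠ 0) :
    K.1 *ᵥ u ≠ 0 := by
  intro h
  apply hu
  have := congrArg (fun x => (K⁻¹).1 *ᵥ x) h
  simpa [mulVec_mulVec, ← Units.val_mul] using this

/-- Right multiplication by an invertible `A` with `v A = w` injects the kernels sending `u` to `v`
into those sending `u` to `w`, so `u K` is uniform on nonzero vectors. -/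
lemma card_vecMul_vanish_le {u : Fin n → ZMod 2} (hu : u ≠ 0) (E : Finset (Fin n)) :
    #{K : GL (Fin n) (ZMod 2) | ∀ j ∉ E, (u ᵥ* K.1) j = 0} * 2 ^ n ≤
      Fintype.card (GL (Fin n) (ZMod 2)) * 2 ^ #E := by
  have := card_filter_mem_mul_card_le (fun K : GL (Fin n) (ZMod 2) => u ᵥ* K.1)
    (fun K => vecMul_GL_ne_zero K hu) (fun v w hv hw => ?_)
    (univ.filter fun x : Fin n → ZMod 2 => ∀ j ∉ E, x j = 0) (by simp)
  · rw [card_filter_forall_notMem_eq_zero] at this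
    simpa using this
  · obtain ⟨A, hA⟩ := exists_GL_vecMul_eq hv hw
    refine card_le_card_of_injOn (· * A) (fun K hK => ?_) (mul_left_injective A).injOn
    have hK' : u ᵥ* K.1 = v := by simpa using hK
    simp [← vecMul_vecMul, hK', hA]

lemma card_mulVec_inv_vanish_le {t : Fin n → ZMod 2} (ht : t ≠ 0) (E : Finset (Fin n)) :
    #{K : GL (Fin n) (ZMod 2) | ∀ j ∉ E, ((K⁻¹).1 *ᵥ t) j = 0} * 2 ^ n ≤
      Fintype.card (GL (Fin n) (ZMod 2)) * 2 ^ #E := by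
  have := card_filter_mem_mul_card_le (fun K : GL (Fin n) (ZMod 2) => (K⁻¹).1 *ᵥ t)
    (fun K => mulVec_GL_ne_zero K⁻¹ ht) (fun v w hv hw => ?_)
    (univ.filter fun x : Fin n → ZMod 2 => ∀ j ∉ E, x j = 0) (by simp)
  · rw [card_filter_forall_notMem_eq_zero] at this
    simpa using this
  · obtain ⟨A, hA⟩ := exists_GL_mulVec_eq hv hw
    refine card_le_card_of_injOn (· * A⁻¹) (fun K hK => ?_) (mul_left_injective A⁻¹).injOn
    have hK' : (K⁻¹).1 *ᵥ t = v := by simpa using hK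
    have : ((K * A⁻¹)⁻¹).1 *ᵥ t = w := by
      rw [_root_.mul_inv_rev, inv_inv, Units.val_mul, ← mulVec_mulVec, hK', hA]
    exact mem_coe.2 (mem_filter.2 ⟨mem_univ _, this⟩)

/-- If a bit is determined, then a parity check on the unerased positions determines it. -/
lemma exists_of_not_undetermined (K : GL (Fin n) (ZMod 2)) (i : Fin n) (E : Finset (Fin n))
    (h : ¬ Undetermined K.1 i E) :
    ∃ t : Fin n → ZMod 2, ((∀ j, i < j → t j = 0) ∧ t i = 1) ∧
      ∀ j ∈ E, ((K⁻¹).1 *ᵥ t) j = 0 := by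
  let R : (Fin n → ZMod 2) →ₗ[ZMod 2] ({j // j ∉ E} → ZMod 2) :=
    LinearMap.funLeft _ _ Subtype.val ∘ₗ K.1.vecMulLinear
  let P : Submodule (ZMod 2) (Fin n → ZMod 2) :=
    { carrier := {u | ∀ j ≤ i, u j = 0}
      add_mem' := fun ha hb j hj => by simp [ha j hj, hb j hj]
      zero_mem' := fun _ _ => rfl
      smul_mem' := fun c x hx j hj => by simp [hx j hj] }
  -- `R` reads the unerased outputs and `P` consists of the words supported after `i`. If the image
  -- of the `i`-th unit word lay in `P.map R`, a difference would witness `Undetermined`.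
  have hv : R (Pi.single i 1) ∉ P.map R := by
    rintro ⟨w, hw, hRw⟩
    refine h ⟨Pi.single i 1 - w, fun j hj => ?_, ?_, fun j hj => ?_⟩
    · have := hw j hj.le
      simp [this, hj.ne]
    · have := hw i le_rfl
      simp [this]
    · have := congrFun hRw ⟨j, hj⟩
      have h2 : (w ᵥ* K.1) j = (Pi.single i 1 ᵥ* K.1) j := this
      rw [sub_vecMul, Pi.sub_apply, h2, sub_self]
  -- The separating functional, extended by zero on `E`, is the parity check `x`. The required
  -- vector is `t = K x`, whose coordinates are the values of `φ` on the images of unit words.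
  obtain ⟨φ, hφ, hker⟩ := Submodule.exists_le_ker_of_notMem hv
  let x : Fin n → ZMod 2 := fun j => if hj : j ∉ E then φ (Pi.single ⟨j, hj⟩ 1) else 0
  have hx : ∀ u : Fin n → ZMod 2, φ (R u) = (u ᵥ* K.1) ⬝ᵥ x := by
    intro u
    rw [LinearMap.pi_apply_eq_sum_univ φ]
    simp only [dotProduct, smul_eq_mul]
    rw [← sum_subset (subset_univ (univ.filter (· ∉ E)))]
    · rw [sum_subtype (p := (· ∉ E)) (univ.filter (· ∉ E)) (by simp)]
      refine sum_congr rfl fun j _ => ?_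
      have hj := j.2
      simp only [x, dif_pos hj]
      congr 2
      ext k
      simp [Pi.single_apply, eq_comm]
    · intro j _ hj
      have : j ∈ E := by simpa using hj
      simp [x, this]
  have hcoord : ∀ j, φ (R (Pi.single j 1)) = (K.1 *ᵥ x) j := by
    intro j
    rw [hx, ← dotProduct_mulVec, single_one_dotProduct]
  refine ⟨K.1 *ᵥ x, ⟨fun j hj => ?_, ?_⟩, fun j hj => ?_⟩
  · rw [← hcoord]
    refine hker ⟨Pi.single j 1, fun k hk => ?_, rfl⟩
    simp [(hk.trans_lt hj).ne]
  · rw [← hcoord]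
    generalize φ (R (Pi.single i 1)) = c at hφ
    revert c
    decide
  · rw [mulVec_mulVec, ← Units.val_mul]
    simp [x, hj]

open Classical in
-- Union bound over the `2 ^ (n - 1 - i)` possible witnesses, each of which works with probability
-- at most `2 ^ (#E - n)`.
lemma card_undetermined_le (i : Fin n) (E : Finset (Fin n)) :
    #{K : GL (Fin n) (ZMod 2) | Undetermined K.1 i E} * 2 ^ ((i : ℕ) + 1) ≤
      Fintype.card (GL (Fin n) (ZMod 2)) * 2 ^ #E := by
  set U := univ.filter fun u : Fin n → ZMod 2 => (∀ j < i, u j = 0) ∧ u i = 1 with hU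
  have hsub : (univ.filter fun K : GL (Fin n) (ZMod 2) => Undetermined K.1 i E) ⊆
      U.biUnion fun u => univ.filter fun K : GL (Fin n) (ZMod 2) =>
        ∀ j ∉ E, (u ᵥ* K.1) j = 0 := by
    intro K hK
    obtain ⟨u, h1, h2, h3⟩ := (mem_filter.1 hK).2
    simp only [mem_biUnion, mem_filter, mem_univ, true_and]
    exact ⟨u, by simp [hU, h2]; exact h1, h3⟩
  have h1 := (card_le_card hsub).trans card_biUnion_le
  have h2 : #{K : GL (Fin n) (ZMod 2) | Undetermined K.1 i E} * 2 ^ n ≤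
      2 ^ (n - 1 - i) * (Fintype.card (GL (Fin n) (ZMod 2)) * 2 ^ #E) := by
    rw [← card_filter_lt_eq_zero i, ← hU, ← smul_eq_mul (#U), ← sum_const]
    refine (Nat.mul_le_mul_right _ h1).trans ?_
    rw [sum_mul]
    refine sum_le_sum fun u hu => card_vecMul_vanish_le ?_ E
    rintro rfl
    simp [hU] at hu
  have h3 : 2 ^ n = 2 ^ (n - 1 - (i : ℕ)) * 2 ^ ((i : ℕ) + 1) := by
    rw [← pow_add]
    congr 1
    omega
  rw [h3] at h2
  refine Nat.le_of_mul_le_mul_left ?_ (pow_pos two_pos (n - 1 - (i : ℕ)))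
  calc _ = _ := by ring
    _ ≤ _ := h2

open Classical in
-- Union bound over the `2 ^ i` possible vectors `t` of `exists_of_not_undetermined`, each of which
-- works with probability at most `2 ^ (-#E)`.
lemma card_not_undetermined_le (i : Fin n) (E : Finset (Fin n)) :
    #{K : GL (Fin n) (ZMod 2) | ¬ Undetermined K.1 i E} * 2 ^ #E ≤
      Fintype.card (GL (Fin n) (ZMod 2)) * 2 ^ (i : ℕ) := by
  set U := univ.filter fun u : Fin n → ZMod 2 => (∀ j, i < j → u j = 0) ∧ u i = 1 with hU
  have hsub : (univ.filter fun K : GL (Fin n) (ZMod 2) => ¬ Undetermined K.1 i E) ⊆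
      U.biUnion fun u => univ.filter fun K : GL (Fin n) (ZMod 2) =>
        ∀ j ∉ Eᶜ, ((K⁻¹).1 *ᵥ u) j = 0 := by
    intro K hK
    obtain ⟨u, h1, h3⟩ := exists_of_not_undetermined K i E (mem_filter.1 hK).2
    simp only [mem_biUnion, mem_filter, mem_univ, true_and]
    exact ⟨u, by simpa [hU] using h1, fun j hj => h3 j (by simpa using hj)⟩
  have h1 := (card_le_card hsub).trans card_biUnion_le
  have h2 : #{K : GL (Fin n) (ZMod 2) | ¬ Undetermined K.1 i E} * 2 ^ n ≤
      2 ^ (i : ℕ) * (Fintype.card (GL (Fin n) (ZMod 2)) * 2 ^ #Eᶜ) := by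
    rw [← card_filter_gt_eq_zero i, ← hU, ← smul_eq_mul (#U), ← sum_const]
    refine (Nat.mul_le_mul_right _ h1).trans ?_
    rw [sum_mul]
    refine sum_le_sum fun u hu => card_mulVec_inv_vanish_le ?_ _
    rintro rfl
    simp [hU] at hu
  have h3 : 2 ^ n = 2 ^ #Eᶜ * 2 ^ #E := by
    rw [← pow_add, card_compl_add_card, Fintype.card_fin]
  rw [h3] at h2
  refine Nat.le_of_mul_le_mul_left ?_ (pow_pos two_pos #Eᶜ)
  calc _ = _ := by ring
    _ ≤ _ := h2
    _ = _ := by ring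

end PolarKernel

/-! ### Exponential-moment bounds for binomial sums, and bounds on `g`. -/

namespace PolarKernel

open Finset Filter Topology

/-- The probability that a random subset of `Fin n`, each element of which is chosen with
probability `z`, belongs to a family with `N e` members of each size `e`. -/
def binomialSum (n : ℕ) (N : ℕ → ℕ) (z : ℝ) : ℝ :=
  ∑ e ∈ range (n + 1), (N e : ℝ) * (z ^ e * (1 - z) ^ (n - e))

lemma binomialSum_nonneg (n : ℕ) (N : ℕ → ℕ) {z : ℝ} (hz : z ∈ Set.Ioo (0 : ℝ) 1) :
    0 ≤ binomialSum n N z := by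
  have h1 : 0 < z := hz.1
  have h2 : 0 < 1 - z := sub_pos.2 hz.2
  exact sum_nonneg fun e _ => by positivity

lemma binomialSum_add {n : ℕ} {N M : ℕ → ℕ} (h : ∀ e, N e + M e = n.choose e) (z : ℝ) :
    binomialSum n N z + binomialSum n M z = 1 := by
  have := add_pow z (1 - z) n
  rw [add_sub_cancel, one_pow] at this
  rw [this, binomialSum, binomialSum, ← sum_add_distrib]
  refine sum_congr rfl fun e _ => ?_
  rw [← h e]
  push_cast
  ring

lemma binomialSum_reflect (n : ℕ) (N : ℕ → ℕ) (z : ℝ) :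
    binomialSum n (fun e => N (n - e)) (1 - z) = binomialSum n N z := by
  rw [binomialSum, binomialSum, ← sum_range_reflect]
  refine sum_congr rfl fun e he => ?_
  have : e ≤ n := Nat.lt_succ_iff.1 (mem_range.1 he)
  rw [show n + 1 - 1 - e = n - e by omega, Nat.sub_sub_self this]
  ring

/-- Chernoff's method: the binomial theorem evaluates the generating function as `(1 + z (y - 1)) ^
n`, which `1 + x ≤ exp x` bounds. -/
lemma binomialSum_le_mul_exp {n : ℕ} {N : ℕ → ℕ} {A y z : ℝ} (hz : z ∈ Set.Ioo (0 : ℝ) 1)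
    (hA : 0 ≤ A) (hy : 0 ≤ y) (h : ∀ e ≤ n, (N e : ℝ) ≤ A * y ^ e * n.choose e) :
    binomialSum n N z ≤ A * Real.exp (n * (z * (y - 1))) := by
  have h1 : 0 < z := hz.1
  have h2 : 0 < 1 - z := sub_pos.2 hz.2
  calc binomialSum n N z
      ≤ ∑ e ∈ range (n + 1), A * ((z * y) ^ e * (1 - z) ^ (n - e) * n.choose e) := by
        refine sum_le_sum fun e he => ?_
        calc (N e : ℝ) * (z ^ e * (1 - z) ^ (n - e))
            ≤ (A * y ^ e * n.choose e) * (z ^ e * (1 - z) ^ (n - e)) :=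
              mul_le_mul_of_nonneg_right (h e (Nat.lt_succ_iff.1 (mem_range.1 he)))
                (by positivity)
          _ = _ := by rw [mul_pow]; ring
    _ = A * (z * y + (1 - z)) ^ n := by rw [add_pow, mul_sum]
    _ ≤ A * Real.exp (z * (y - 1)) ^ n := by
        gcongr
        have := Real.add_one_le_exp (z * (y - 1))
        linarith
    _ = _ := by rw [← Real.exp_nat_mul]

lemma binomialSum_le_pow {n k : ℕ} {N : ℕ → ℕ} {z : ℝ} (hz : z ∈ Set.Ioo (0 : ℝ) 1)
    (hn : 0 < n) (hnz : n * z ≤ 1) (hN : ∀ e, N e ≤ n.choose e) (h0 : ∀ e < k, N e = 0) :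
    binomialSum n N z ≤ 3 * (n * z) ^ k := by
  have h1 : 0 < z := hz.1
  have hn' : (0 : ℝ) < n := by exact_mod_cast hn
  have hp : 0 < n * z := by positivity
  -- With `y = 1 / (n z) ≥ 1`, the factor `A * y ^ e` is at least `1` once `e ≥ k`, and the
  -- exponential is at most `e < 3`.
  have := binomialSum_le_mul_exp (n := n) (N := N) (A := (n * z) ^ k) (y := (n * z)⁻¹) hz (by positivity)
    (by positivity) ?_
  · refine this.trans ?_
    rw [mul_comm]
    gcongr
    have h3 : (n : ℝ) * (z * ((n * z)⁻¹ - 1)) = 1 - n * z := by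
      field_simp
    rw [h3]
    exact (Real.exp_le_exp.2 (by linarith)).trans Real.exp_one_lt_three.le
  · intro e _
    rcases lt_or_ge e k with he | he
    · rw [h0 e he]
      push_cast
      positivity
    · have h4 : (1 : ℝ) ≤ (n * z) ^ k * (n * z)⁻¹ ^ e := by
        obtain ⟨d, rfl⟩ := Nat.exists_eq_add_of_le he
        rw [pow_add, inv_pow (n * z) k, ← mul_assoc, mul_inv_cancel₀ (by positivity), one_mul]
        exact one_le_pow₀ ((one_le_inv₀ hp).2 hnz)
      calc (N e : ℝ) ≤ 1 * n.choose e := by rw [one_mul]; exact_mod_cast hN e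
        _ ≤ _ := by gcongr

/-- Take `y = exp s`. Since `exp s - 1 ≤ s + s ^ 2` and `n * s ^ 2 ≤ 1`, the second-order term costs
only a factor `e < 3`. -/
lemma binomialSum_le_exp {n : ℕ} {N : ℕ → ℕ} {A c s z : ℝ} (hz : z ∈ Set.Ioo (0 : ℝ) 1)
    (hA : 0 ≤ A) (hs : |s| ≤ 1) (hns : n * s ^ 2 ≤ 1)
    (hN : ∀ e ≤ n, (N e : ℝ) ≤ A * Real.exp (s * (e - c)) * n.choose e) :
    binomialSum n N z ≤ 3 * A * Real.exp (s * (n * z - c)) := by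
  have h1 : 0 < z := hz.1
  refine (binomialSum_le_mul_exp (A := A * Real.exp (-(s * c))) (y := Real.exp s) hz
    (by positivity) (by positivity) fun e he => ?_).trans ?_
  · refine (hN e he).trans_eq ?_
    rw [← Real.exp_nat_mul, mul_assoc A (Real.exp (-(s * c))), ← Real.exp_add]
    ring_nf
  · have h2 : Real.exp s - 1 ≤ s + s ^ 2 := by
      have := (abs_le.1 (Real.abs_exp_sub_one_sub_id_le hs)).2
      linarith
    have h3 : n * (z * (Real.exp s - 1)) ≤ s * (n * z) + 1 := by
      calc n * (z * (Real.exp s - 1)) ≤ n * (z * (s + s ^ 2)) := by gcongr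
        _ = s * (n * z) + z * (n * s ^ 2) := by ring
        _ ≤ s * (n * z) + 1 * 1 := by
          gcongr
          exact hz.2.le
        _ = _ := by ring
    calc A * Real.exp (-(s * c)) * Real.exp (n * (z * (Real.exp s - 1)))
        ≤ A * Real.exp (-(s * c)) * Real.exp (s * (n * z) + 1) := by gcongr
      _ = Real.exp 1 * A * Real.exp (s * (n * z - c)) := by
        rw [mul_sub, sub_eq_neg_add, Real.exp_add, Real.exp_add]
        ring
      _ ≤ _ := by
        gcongr
        exact Real.exp_one_lt_three.le

/-- The bounds `1` and `A * 2 ^ (e - i)` together lie below `A * exp (s * (e - i))` for every slope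
`s` up to `log 2`. This freedom allows a slope of order `1 / √n`. -/
lemma le_mul_exp_of_mul_two_pow_le {N A C e i : ℕ} {s : ℝ} (hs0 : 0 ≤ s) (hs : s ≤ Real.log 2)
    (hA : 1 ≤ A) (h1 : N ≤ C) (h2 : N * 2 ^ i ≤ A * 2 ^ e * C) :
    (N : ℝ) ≤ A * Real.exp (s * (e - i)) * C := by
  rcases le_total i e with h | h
  · have hx : (1 : ℝ) ≤ Real.exp (s * (e - i)) :=
      Real.one_le_exp (mul_nonneg hs0 (sub_nonneg.2 (by exact_mod_cast h)))
    have hA' : (1 : ℝ) ≤ A := by exact_mod_cast hA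
    calc (N : ℝ) ≤ 1 * 1 * C := by simpa using h1
      _ ≤ _ := by gcongr
  · have hx : (2 : ℝ) ^ e / 2 ^ i ≤ Real.exp (s * (e - i)) := by
      have h3 : (2 : ℝ) ^ e / 2 ^ i = Real.exp (Real.log 2 * (e - i)) := by
        rw [mul_sub, Real.exp_sub, mul_comm, Real.exp_nat_mul, mul_comm (Real.log 2),
          Real.exp_nat_mul, Real.exp_log two_pos]
      have h4 : (e : ℝ) ≤ i := by exact_mod_cast h
      rw [h3]
      exact Real.exp_le_exp.2 (mul_le_mul_of_nonpos_right hs (sub_nonpos.2 h4))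
    calc (N : ℝ) = N * 2 ^ i / 2 ^ i := by field_simp
      _ ≤ A * 2 ^ e * C / 2 ^ i :=
        div_le_div_of_nonneg_right (by exact_mod_cast h2) (by positivity)
      _ = A * (2 ^ e / 2 ^ i) * C := by ring
      _ ≤ _ := by gcongr

/-- The number of natural numbers in a real interval. -/
lemma card_filter_fin_le (n : ℕ) {a b : ℝ} (hab : a ≤ b) :
    (#{i : Fin n | a ≤ (i : ℕ) ∧ (i : ℕ) ≤ b} : ℝ) ≤ b - a + 1 := by
  have h1 : #{i : Fin n | a ≤ (i : ℕ) ∧ (i : ℕ) ≤ b} ≤ #(Icc ⌈a⌉ ⌊b⌋) := by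
    refine card_le_card_of_injOn (fun i => ((i : ℕ) : ℤ)) (fun i hi => ?_)
      (fun i _ j _ h => by simpa [Fin.ext_iff] using h)
    have hi' := (mem_filter.1 (mem_coe.1 hi)).2
    exact mem_coe.2 (mem_Icc.2 ⟨Int.ceil_le.2 (by exact_mod_cast hi'.1),
      Int.le_floor.2 (by exact_mod_cast hi'.2)⟩)
  rw [Int.card_Icc] at h1
  have h2 : (((⌊b⌋ + 1 - ⌈a⌉).toNat : ℤ) : ℝ) ≤ b - a + 1 := by
    rcases le_total 0 (⌊b⌋ + 1 - ⌈a⌉) with h | h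
    · rw [Int.toNat_of_nonneg h]
      push_cast
      linarith [Int.floor_le b, Int.le_ceil a]
    · rw [Int.toNat_of_nonpos h]
      push_cast
      linarith
  calc _ ≤ (((⌊b⌋ + 1 - ⌈a⌉).toNat : ℕ) : ℝ) := by exact_mod_cast h1
    _ ≤ _ := by exact_mod_cast h2

lemma g_pos (α : ℝ) {x : ℝ} (hx : x ∈ Set.Ioo (0 : ℝ) 1) : 0 < g α x :=
  mul_pos (Real.rpow_pos_of_pos hx.1 _) (Real.rpow_pos_of_pos (sub_pos.2 hx.2) _)

lemma g_one_sub (α x : ℝ) : g α (1 - x) = g α x := by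
  rw [g, g, sub_sub_cancel, mul_comm]

lemma g_le_rpow {α x b : ℝ} (hα : 0 ≤ α) (h0 : 0 ≤ x) (h1 : x ≤ 1) (hb : x ≤ b) :
    g α x ≤ b ^ α := by
  have h2 : (1 - x) ^ α ≤ 1 := Real.rpow_le_one (by linarith) (by linarith) hα
  calc g α x ≤ x ^ α * 1 := mul_le_mul_of_nonneg_left h2 (Real.rpow_nonneg h0 _)
    _ = x ^ α := mul_one _
    _ ≤ b ^ α := Real.rpow_le_rpow h0 hb hα

lemma g_le_one {α x : ℝ} (hα : 0 ≤ α) (h0 : 0 ≤ x) (h1 : x ≤ 1) : g α x ≤ 1 := by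
  simpa using g_le_rpow hα h0 h1 h1

lemma rpow_div_two_le_g {α z w : ℝ} (hα0 : 0 ≤ α) (hα1 : α ≤ 1) (hz : z ≤ 1 / 2) (hw : 0 ≤ w)
    (hwz : w ≤ z) : w ^ α / 2 ≤ g α z := by
  have h1 : (1 / 2 : ℝ) ≤ (1 - z) ^ α := by
    calc (1 / 2 : ℝ) = (1 / 2) ^ (1 : ℝ) := by simp
      _ ≤ (1 / 2) ^ α := Real.rpow_le_rpow_of_exponent_ge (by norm_num) (by norm_num) hα1
      _ ≤ _ := Real.rpow_le_rpow (by norm_num) (by linarith) hα0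
  calc w ^ α / 2 = w ^ α * (1 / 2) := by ring
    _ ≤ z ^ α * (1 - z) ^ α := by
      have := Real.rpow_le_rpow hw hwz hα0
      have := Real.rpow_nonneg (hw.trans hwz) α
      gcongr

/-! ### From sharp counts to the bound on the sum of `g`. -/

/-- Counts `N i e` and `M i e` of the erasure patterns of size `e` for which the bit `i` is
undetermined, respectively determined, when the transition between the two is sharp. -/
structure SharpCounts (n : ℕ) (N M : Fin n → ℕ → ℕ) : Prop where
  add_eq : ∀ i e, N i e + M i e = n.choose e
  left_zero : ∀ i, N i 0 = 0
  right_last : ∀ i, M i n = 0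
  left_le : ∀ i e, e ≤ n → N i e * 2 ^ ((i : ℕ) + 1) ≤ n ^ 4 * 2 ^ e * n.choose e
  right_le : ∀ i e, e ≤ n → M i e * 2 ^ e ≤ n ^ 4 * 2 ^ (i : ℕ) * n.choose e

namespace SharpCounts

variable {n : ℕ} {N M : Fin n → ℕ → ℕ} {α z : ℝ}

lemma le_choose_left (h : SharpCounts n N M) (i : Fin n) (e : ℕ) : N i e ≤ n.choose e :=
  h.add_eq i e ▸ Nat.le_add_right _ _

lemma le_choose_right (h : SharpCounts n N M) (i : Fin n) (e : ℕ) : M i e ≤ n.choose e :=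
  h.add_eq i e ▸ Nat.le_add_left _ _

lemma binomialSum_le_one (h : SharpCounts n N M) (hz : z ∈ Set.Ioo (0 : ℝ) 1) (i : Fin n) :
    binomialSum n (N i) z ≤ 1 := by
  linarith [binomialSum_add (h.add_eq i) z, binomialSum_nonneg n (M i) hz]

/-- Exchange of the roles of erased and unerased positions. -/
lemma reflect (h : SharpCounts n N M) :
    SharpCounts n (fun i e => if e ≤ n then M i.rev (n - e) else 0)
      (fun i e => if e ≤ n then N i.rev (n - e) else 0) where
  add_eq i e := by
    split_ifs with he
    · rw [add_comm, h.add_eq, Nat.choose_symm he]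
    · rw [Nat.choose_eq_zero_of_lt (by omega)]
  left_zero i := by simp [h.right_last]
  right_last i := by simp [h.left_zero]
  left_le i e he := by
    have := h.right_le i.rev (n - e) (by omega)
    rw [Nat.choose_symm he, Fin.val_rev] at this
    rw [if_pos he]
    -- As `i.rev = n - (i + 1)`, reflection exchanges the exponents `i + 1` and `i` of the two
    -- bounds. A common power of two removes the truncated subtractions.
    refine Nat.le_of_mul_le_mul_right ?_ (pow_pos two_pos (n - (i + 1)))
    have h1 : 2 ^ n = 2 ^ ((i : ℕ) + 1) * 2 ^ (n - (i + 1)) := by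
      rw [← pow_add]; congr 1; omega
    have h2 : 2 ^ n = 2 ^ (n - e) * 2 ^ e := by
      rw [← pow_add]; congr 1; omega
    rw [mul_assoc, ← h1, h2]
    nlinarith [Nat.mul_le_mul_right (2 ^ e) this]
  right_le i e he := by
    have := h.left_le i.rev (n - e) (by omega)
    rw [Nat.choose_symm he, Fin.val_rev] at this
    rw [if_pos he]
    refine Nat.le_of_mul_le_mul_right ?_ (pow_pos two_pos (n - (i + 1) + 1))
    have h1 : 2 ^ n = 2 ^ (i : ℕ) * 2 ^ (n - (i + 1) + 1) := by
      rw [← pow_add]; congr 1; omega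
    have h2 : 2 ^ n = 2 ^ (n - e) * 2 ^ e := by
      rw [← pow_add]; congr 1; omega
    have h3 : n ^ 4 * 2 ^ (i : ℕ) * n.choose e * 2 ^ (n - (i + 1) + 1) =
        n ^ 4 * n.choose e * 2 ^ n := by rw [h1]; ring
    rw [h3, h2]
    nlinarith [Nat.mul_le_mul_right (2 ^ e) this]

/-- The bound `left_le` falls below `1`, and a count is an integer. -/
lemma left_eq_zero (h : SharpCounts n N M) {k : ℕ} (hn : 1 ≤ n)
    (hk : (n : ℝ) ^ 4 * 2 ^ k * n ^ k < 2 ^ √(n : ℝ)) {i : Fin n}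
    (hi : √(n : ℝ) ≤ (i : ℕ)) {e : ℕ} (he : e < k) : N i e = 0 := by
  by_contra hne
  rcases lt_or_ge n e with hen | hen
  · have := h.le_choose_left i e
    rw [Nat.choose_eq_zero_of_lt hen] at this
    omega
  have h1 : 1 ≤ N i e := Nat.one_le_iff_ne_zero.2 hne
  have h2 : 2 ^ (i : ℕ) ≤ n ^ 4 * 2 ^ k * n ^ k := by
    calc 2 ^ (i : ℕ) ≤ 1 * 2 ^ ((i : ℕ) + 1) := by
          rw [one_mul]; exact Nat.pow_le_pow_right two_pos (Nat.le_succ _)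
      _ ≤ N i e * 2 ^ ((i : ℕ) + 1) := Nat.mul_le_mul_right _ h1
      _ ≤ n ^ 4 * 2 ^ e * n.choose e := h.left_le i e hen
      _ ≤ n ^ 4 * 2 ^ k * n ^ k := by
        gcongr
        · exact one_le_two
        · exact (Nat.choose_le_pow n e).trans (Nat.pow_le_pow_right hn he.le)
  have h3 : (2 : ℝ) ^ √(n : ℝ) ≤ 2 ^ (i : ℕ) := by
    rw [← Real.rpow_natCast]
    exact Real.rpow_le_rpow_of_exponent_le one_le_two hi
  have h4 : ((2 : ℝ) ^ (i : ℕ)) ≤ (n : ℝ) ^ 4 * 2 ^ k * n ^ k := by exact_mod_cast h2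
  linarith

/-- Since `g α z` may be arbitrarily small, every term must carry a factor `z ^ α`. The roughly `√n`
first bits contribute at most `B` each, all the others together at most `B`. -/
lemma sum_g_le_of_le_inv_sq (h : SharpCounts n N M) (hα0 : 0 < α) (hα1 : α ≤ 1) (hn : 1 ≤ n)
    (hnα : 18 ≤ (n : ℝ) ^ α) {k : ℕ} (hkα : 1 + 1 / α ≤ k)
    (hk : (n : ℝ) ^ 4 * 2 ^ k * n ^ k < 2 ^ √(n : ℝ))
    (hz : z ∈ Set.Ioo (0 : ℝ) 1) (hz2 : z ≤ 1 / 2) (hzn : z ≤ 1 / (n : ℝ) ^ 2) :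
    ∑ i, g α (binomialSum n (N i) z) ≤ (n : ℝ) ^ (1 / 2 + 5 * α) * g α z := by
  have hz0 : 0 < z := hz.1
  have hn1 : (1 : ℝ) ≤ n := by exact_mod_cast hn
  have hn0 : (0 : ℝ) < n := by linarith
  have hnz' : n * z ≤ 1 / n := by
    calc n * z ≤ n * (1 / (n : ℝ) ^ 2) := by gcongr
      _ = 1 / n := by field_simp
  have hnz : n * z ≤ 1 := hnz'.trans (by rw [div_le_one hn0]; exact hn1)
  have hk1 : 1 ≤ k := by
    have : (1 : ℝ) < k := by
      have : 0 < 1 / α := by positivity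
      linarith
    exact_mod_cast this.le
  have hsq : 1 ≤ √(n : ℝ) := Real.one_le_sqrt.2 hn1
  set B := (3 * (n * z)) ^ α with hB
  have hB0 : 0 ≤ B := by positivity
  have hterm : ∀ i : Fin n, g α (binomialSum n (N i) z) ≤
      (if (0 : ℝ) ≤ (i : ℕ) ∧ ((i : ℕ) : ℝ) ≤ √n then B else 0) + B / n := by
    intro i
    have hF0 := binomialSum_nonneg n (N i) hz
    have hF1 := h.binomialSum_le_one hz i
    split_ifs with hi
    · have h1 : binomialSum n (N i) z ≤ 3 * (n * z) := by
        simpa using binomialSum_le_pow (k := 1) hz hn hnz (h.le_choose_left i)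
          (fun e he => by rw [Nat.lt_one_iff.1 he, h.left_zero])
      have := g_le_rpow hα0.le hF0 hF1 h1
      have : 0 ≤ B / n := by positivity
      linarith
    · have hi' : √(n : ℝ) ≤ (i : ℕ) := by
        by_contra hlt
        exact hi ⟨Nat.cast_nonneg _, (not_le.1 hlt).le⟩
      have h1 : binomialSum n (N i) z ≤ 3 * (n * z) ^ k :=
        binomialSum_le_pow hz hn hnz (h.le_choose_left i) fun e he => h.left_eq_zero hn hk hi' he
      -- One factor `n z` is kept to produce `B`. The other `k - 1 ≥ 1 / α` factors, each at most `1
      -- / n`, give `1 / n` after raising to the power `α`.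
      have h2 : 3 * (n * z) ^ k ≤ 3 * (n * z) * (1 / n) ^ (k - 1) := by
        obtain ⟨m, rfl⟩ := Nat.exists_eq_add_of_le' hk1
        rw [pow_succ, Nat.add_sub_cancel]
        calc 3 * ((n * z) ^ m * (n * z)) = 3 * (n * z) * (n * z) ^ m := by ring
          _ ≤ _ := by gcongr
      refine (g_le_rpow hα0.le hF0 hF1 (h1.trans h2)).trans ?_
      rw [zero_add, Real.mul_rpow (by positivity) (by positivity), ← hB, div_eq_mul_one_div B]
      refine mul_le_mul_of_nonneg_left ?_ hB0
      rw [← Real.rpow_natCast, ← Real.rpow_mul (by positivity)]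
      calc (1 / (n : ℝ)) ^ (((k - 1 : ℕ) : ℝ) * α) ≤ (1 / (n : ℝ)) ^ (1 : ℝ) := by
            refine Real.rpow_le_rpow_of_exponent_ge (by positivity)
              (by rw [div_le_one hn0]; exact hn1) ?_
            rw [Nat.cast_sub hk1, Nat.cast_one]
            have h3 : 1 / α ≤ (k : ℝ) - 1 := by linarith
            calc 1 = 1 / α * α := by field_simp
              _ ≤ _ := by gcongr
        _ = 1 / n := Real.rpow_one _
  have hcard := card_filter_fin_le n (Real.sqrt_nonneg (n : ℝ))
  calc ∑ i, g α (binomialSum n (N i) z)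
      ≤ ∑ i : Fin n, ((if (0 : ℝ) ≤ (i : ℕ) ∧ ((i : ℕ) : ℝ) ≤ √n then B else 0) + B / n) :=
        sum_le_sum fun i _ => hterm i
    _ = #{i : Fin n | (0 : ℝ) ≤ (i : ℕ) ∧ ((i : ℕ) : ℝ) ≤ √n} * B + B := by
        rw [sum_add_distrib, ← sum_filter, sum_const, sum_const, card_univ, Fintype.card_fin]
        simp only [nsmul_eq_mul]
        field_simp
    _ ≤ (√n - 0 + 1) * B + B := by gcongr
    _ ≤ 3 * √n * B := by nlinarith
    _ ≤ 3 * √n * (3 * (n : ℝ) ^ α * z ^ α) := by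
        gcongr
        rw [hB, Real.mul_rpow (by norm_num) (by positivity), Real.mul_rpow hn0.le hz0.le, ← mul_assoc]
        gcongr
        calc (3 : ℝ) ^ α ≤ 3 ^ (1 : ℝ) := Real.rpow_le_rpow_of_exponent_le (by norm_num) hα1
          _ = 3 := Real.rpow_one _
    _ = √n * (n : ℝ) ^ α * 18 * (z ^ α / 2) := by ring
    _ ≤ √n * (n : ℝ) ^ α * (n : ℝ) ^ α * g α z := by
        have := rpow_div_two_le_g hα0.le hα1 hz2 hz0.le le_rfl
        gcongr
    _ = (n : ℝ) ^ (1 / 2 + 2 * α) * g α z := by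
        rw [Real.sqrt_eq_rpow, ← Real.rpow_add hn0, ← Real.rpow_add hn0]
        ring_nf
    _ ≤ _ := by
        have := (g_pos α hz).le
        gcongr
        norm_num

lemma sum_g_le_of_inv_sq_le (h : SharpCounts n N M) (hα0 : 0 < α) (hα1 : α ≤ 1) (hn : 4 ≤ n)
    (hnα : 18 ≤ (n : ℝ) ^ α)
    (hexp : 3 * (n : ℝ) ^ 4 * Real.exp (-(n : ℝ) ^ α) ≤ (n : ℝ) ^ (-(1 / α)))
    (hz : z ∈ Set.Ioo (0 : ℝ) 1) (hz2 : z ≤ 1 / 2) (hzn : 1 / (n : ℝ) ^ 2 ≤ z) :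
    ∑ i, g α (binomialSum n (N i) z) ≤ (n : ℝ) ^ (1 / 2 + 5 * α) * g α z := by
  have hn4 : (4 : ℝ) ≤ n := by exact_mod_cast hn
  have hn0 : (0 : ℝ) < n := by linarith
  have hsq : 2 ≤ √(n : ℝ) := Real.le_sqrt_of_sq_le (by linarith)
  have hsq0 : 0 < √(n : ℝ) := by linarith
  -- The steepest slope with `n * s ^ 2 ≤ 1`; on the half-width `t` of the window it gains `exp (-(n
  -- ^ α))`.
  set s := 1 / √(n : ℝ) with hs
  have hs0 : 0 < s := by positivity
  have hs1 : s ≤ 1 / 2 := by rw [hs]; gcongr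
  have hslog : s ≤ Real.log 2 := by linarith [Real.log_two_gt_d9]
  have hns : n * s ^ 2 ≤ 1 := by
    rw [hs, div_pow, Real.sq_sqrt hn0.le]
    field_simp
    norm_num
  have hn41 : 1 ≤ n ^ 4 := Nat.one_le_pow _ _ (by omega)
  set t := (n : ℝ) ^ (1 / 2 + α) with ht
  have ht1 : 1 ≤ t := Real.one_le_rpow (by linarith) (by linarith)
  have hst : s * t = (n : ℝ) ^ α := by
    rw [hs, ht, Real.rpow_add hn0, ← Real.sqrt_eq_rpow]
    field_simp
  have hsmall : ((n : ℝ) ^ (-(1 / α))) ^ α = 1 / n := by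
    rw [← Real.rpow_mul hn0.le, neg_mul, one_div_mul_cancel hα0.ne', Real.rpow_neg_one, one_div]
  have htail : ∀ x, x ≤ -(s * t) → 3 * ((n ^ 4 : ℕ) : ℝ) * Real.exp x ≤ (n : ℝ) ^ (-(1 / α)) := by
    intro x hx
    refine le_trans ?_ hexp
    push_cast
    gcongr
    rwa [← hst]
  have hterm : ∀ i : Fin n, g α (binomialSum n (N i) z) ≤
      (if n * z - t ≤ (i : ℕ) ∧ ((i : ℕ) : ℝ) ≤ n * z + t then 1 else 0) + 1 / n := by
    intro i
    have hF0 := binomialSum_nonneg n (N i) hz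
    have hF1 := h.binomialSum_le_one hz i
    split_ifs with hi
    · have := g_le_one hα0.le hF0 hF1
      have : 0 ≤ 1 / (n : ℝ) := by positivity
      linarith
    · rw [zero_add, ← hsmall]
      rcases lt_or_ge ((i : ℕ) : ℝ) (n * z - t) with hlt | hge
      -- Below the window the bit is almost surely undetermined, so the complementary sum is
      -- bounded, with the opposite slope.
      · have h1 : binomialSum n (M i) z ≤
            3 * ((n ^ 4 : ℕ) : ℝ) * Real.exp (-s * (n * z - (i : ℕ))) := by
          refine binomialSum_le_exp hz (Nat.cast_nonneg _)
            (by rw [abs_neg, abs_of_pos hs0]; linarith) (by rwa [neg_sq]) fun e he => ?_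
          have := le_mul_exp_of_mul_two_pow_le hs0.le hslog hn41 (h.le_choose_right i e)
            (h.right_le i e he)
          convert this using 4
          ring
        have h2 := h1.trans (htail _ (by nlinarith))
        have h3 : binomialSum n (M i) z = 1 - binomialSum n (N i) z := by
          linarith [binomialSum_add (h.add_eq i) z]
        rw [← g_one_sub]
        rw [h3] at h2
        exact g_le_rpow hα0.le (by linarith) (by linarith) h2
      · have hgt : n * z + t < (i : ℕ) := by
          by_contra hle
          exact hi ⟨hge, not_lt.1 hle⟩
        have h1 : binomialSum n (N i) z ≤
            3 * ((n ^ 4 : ℕ) : ℝ) * Real.exp (s * (n * z - (i : ℕ))) := by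
          refine binomialSum_le_exp hz (Nat.cast_nonneg _)
            (by rw [abs_of_pos hs0]; linarith) hns fun e he => ?_
          refine le_mul_exp_of_mul_two_pow_le hs0.le hslog hn41 (h.le_choose_left i e)
            (le_trans ?_ (h.left_le i e he))
          exact Nat.mul_le_mul_left _ (Nat.pow_le_pow_right two_pos (Nat.le_succ _))
        exact g_le_rpow hα0.le hF0 hF1 (h1.trans (htail _ (by nlinarith)))
  have hcard := card_filter_fin_le n (show n * z - t ≤ n * z + t by linarith)
  have hgz : (n : ℝ) ^ (-(2 * α)) / 2 ≤ g α z := by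
    refine le_trans (le_of_eq ?_) (rpow_div_two_le_g hα0.le hα1 hz2 (by positivity) hzn)
    rw [one_div, Real.inv_rpow (by positivity), Real.rpow_neg hn0.le, ← Real.rpow_natCast,
      ← Real.rpow_mul hn0.le]
    norm_num
  calc ∑ i, g α (binomialSum n (N i) z)
      ≤ ∑ i : Fin n, ((if n * z - t ≤ (i : ℕ) ∧ ((i : ℕ) : ℝ) ≤ n * z + t then (1 : ℝ) else 0)
          + 1 / n) := sum_le_sum fun i _ => hterm i
    _ = #{i : Fin n | n * z - t ≤ (i : ℕ) ∧ ((i : ℕ) : ℝ) ≤ n * z + t} + 1 := by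
        rw [sum_add_distrib, ← sum_filter, sum_const, sum_const, card_univ, Fintype.card_fin]
        simp only [nsmul_eq_mul]
        field_simp
    _ ≤ (n * z + t - (n * z - t) + 1) + 1 := by gcongr
    _ ≤ t * 18 * (1 / 2) := by linarith
    _ ≤ t * (n : ℝ) ^ α * (1 / 2) := by gcongr
    _ = (n : ℝ) ^ (1 / 2 + 4 * α) * ((n : ℝ) ^ (-(2 * α)) / 2) := by
        have : (n : ℝ) ^ (1 / 2 + 4 * α) * (n : ℝ) ^ (-(2 * α)) = t * (n : ℝ) ^ α := by
          rw [ht, ← Real.rpow_add hn0, ← Real.rpow_add hn0]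
          ring_nf
        linarith
    _ ≤ (n : ℝ) ^ (1 / 2 + 4 * α) * g α z := by gcongr
    _ ≤ _ := by
        have := (g_pos α hz).le
        gcongr
        · linarith
        · norm_num

end SharpCounts

end PolarKernel

/-! ### Asymptotic conditions on `n` and the bound for all `z`. -/

namespace PolarKernel

open Finset Filter Topology

lemma eventually_mul_pow_mul_exp_le {α : ℝ} (hα : 0 < α) :
    ∀ᶠ n : ℕ in atTop, 3 * (n : ℝ) ^ 4 * Real.exp (-(n : ℝ) ^ α) ≤ (n : ℝ) ^ (-(1 / α)) := by
  -- At the point `n ^ α` this exponent produces `n ^ (4 + 1 / α)`.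
  have h1 := tendsto_rpow_mul_exp_neg_mul_atTop_nhds_zero ((4 + 1 / α) / α) 1 one_pos
  have h2 := (h1.eventually (eventually_le_nhds (show (0 : ℝ) < 1 / 3 by norm_num)))
  have h3 := ((tendsto_rpow_atTop hα).comp tendsto_natCast_atTop_atTop).eventually h2
  filter_upwards [h3, eventually_gt_atTop 0] with n hn hn0
  have hn0' : (0 : ℝ) < n := by exact_mod_cast hn0
  simp only [Function.comp_apply] at hn
  rw [← Real.rpow_mul hn0'.le, mul_div_cancel₀ _ hα.ne', Real.rpow_add hn0', neg_one_mul] at hn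
  rw [Real.rpow_neg hn0'.le, ← one_div, le_div_iff₀ (by positivity)]
  have h4 : (n : ℝ) ^ (4 : ℝ) = (n : ℝ) ^ 4 := by exact_mod_cast Real.rpow_natCast (n : ℝ) 4
  rw [h4] at hn
  linarith

lemma eventually_pow_lt_two_rpow_sqrt (k : ℕ) :
    ∀ᶠ n : ℕ in atTop, (n : ℝ) ^ 4 * 2 ^ k * n ^ k < 2 ^ √(n : ℝ) := by
  have h1 := tendsto_rpow_mul_exp_neg_mul_atTop_nhds_zero ((2 * (4 + k) : ℕ) : ℝ) (Real.log 2)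
    (Real.log_pos one_lt_two)
  have h2 := (h1.eventually (eventually_lt_nhds (show (0 : ℝ) < 1 / 2 ^ k by positivity)))
  have h3 := (Real.tendsto_sqrt_atTop.comp tendsto_natCast_atTop_atTop).eventually h2
  filter_upwards [h3] with n hn
  simp only [Function.comp_apply] at hn
  rw [Real.rpow_natCast, pow_mul, Real.sq_sqrt (Nat.cast_nonneg _), neg_mul, Real.exp_neg,
    ← div_eq_mul_inv, div_lt_div_iff₀ (by positivity) (by positivity)] at hn
  rw [Real.rpow_def_of_pos two_pos]
  calc (n : ℝ) ^ 4 * 2 ^ k * n ^ k = n ^ (4 + k) * 2 ^ k := by ring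
    _ < _ := by linarith

/-- Sharp counts make the average of `g α` over all bit-channels small, uniformly in `z`. -/
theorem eventually_sum_g_le {α : ℝ} (hα0 : 0 < α) (hα1 : α ≤ 1) :
    ∀ᶠ n : ℕ in atTop, ∀ N M : Fin n → ℕ → ℕ, SharpCounts n N M →
      ∀ z ∈ Set.Ioo (0 : ℝ) 1,
        ∑ i, g α (binomialSum n (N i) z) ≤ (n : ℝ) ^ (1 / 2 + 5 * α) * g α z := by
  obtain ⟨k, hk⟩ := exists_nat_ge (1 + 1 / α)
  have h18 := ((tendsto_rpow_atTop hα0).comp tendsto_natCast_atTop_atTop).eventually_ge_atTop 18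
  filter_upwards [eventually_ge_atTop 4, h18, eventually_mul_pow_mul_exp_le hα0,
    eventually_pow_lt_two_rpow_sqrt k] with n hn4 hn18 hexp hpow
  have half : ∀ N M : Fin n → ℕ → ℕ, SharpCounts n N M → ∀ z ∈ Set.Ioo (0 : ℝ) 1, z ≤ 1 / 2 →
      ∑ i, g α (binomialSum n (N i) z) ≤ (n : ℝ) ^ (1 / 2 + 5 * α) * g α z := by
    intro N M h z hz hz2
    rcases le_total z (1 / (n : ℝ) ^ 2) with hzn | hzn
    · exact h.sum_g_le_of_le_inv_sq hα0 hα1 (by omega) hn18 hk hpow hz hz2 hzn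
    · exact h.sum_g_le_of_inv_sq_le hα0 hα1 hn4 hn18 hexp hz hz2 hzn
  intro N M h z hz
  rcases le_total z (1 / 2) with hz2 | hz2
  · exact half N M h z hz hz2
  -- Reflection replaces `f` at `z` by `1 - f` at the reversed index, and `g` is symmetric.
  · have h1 := half _ _ h.reflect (1 - z) ⟨sub_pos.2 hz.2, by linarith [hz.1]⟩ (by linarith)
    rw [g_one_sub] at h1
    refine le_trans (le_of_eq ?_) h1
    rw [← Equiv.sum_comp Fin.revPerm]
    refine sum_congr rfl fun i _ => ?_
    have h2 : binomialSum n (fun e => if e ≤ n then M i.rev (n - e) else 0) (1 - z) =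
        binomialSum n (M i.rev) z := by
      rw [← binomialSum_reflect n (M i.rev)]
      refine sum_congr rfl fun e he => ?_
      simp only [if_pos (Nat.lt_succ_iff.1 (mem_range.1 he))]
    rw [h2, ← g_one_sub, Fin.revPerm_apply]
    congr 1
    linarith [binomialSum_add (h.add_eq i.rev) z]

/-! ### Sharpness of the counts of a random kernel. -/

variable {n : ℕ}

open Classical in
/-- The number of erasure patterns of size `e` for which the bit `i` is undetermined. -/
def undeterminedCount (K : GL (Fin n) (ZMod 2)) (i : Fin n) (e : ℕ) : ℕ :=
  #{E ∈ powersetCard e univ | Undetermined K.1 i E}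

open Classical in
/-- The number of erasure patterns of size `e` for which the bit `i` is determined. -/
def determinedCount (K : GL (Fin n) (ZMod 2)) (i : Fin n) (e : ℕ) : ℕ :=
  #{E ∈ powersetCard e univ | ¬ Undetermined K.1 i E}

theorem f_eq_binomialSum (K : GL (Fin n) (ZMod 2)) (i : Fin n) {z : ℝ}
    (hz : z ∈ Set.Ioo (0 : ℝ) 1) : f K i z = binomialSum n (undeterminedCount K i) z := by
  classical
  rw [f_eq_sum_finset K i hz, ← powerset_univ, sum_powerset, card_univ, Fintype.card_fin,
    binomialSum]
  refine sum_congr rfl fun e _ => ?_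
  rw [← sum_filter, undeterminedCount, ← nsmul_eq_mul, ← sum_const]
  refine sum_congr ?_ fun E hE => ?_
  · congr
  · rw [(mem_powersetCard.1 (mem_filter.1 hE).1).2]

lemma undeterminedCount_add_determinedCount (K : GL (Fin n) (ZMod 2)) (i : Fin n) (e : ℕ) :
    undeterminedCount K i e + determinedCount K i e = n.choose e := by
  rw [undeterminedCount, determinedCount, card_filter_add_card_filter_not, card_powersetCard,
    card_univ, Fintype.card_fin]

lemma not_undetermined_empty (K : GL (Fin n) (ZMod 2)) (i : Fin n) : ¬ Undetermined K.1 i ∅ := by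
  rintro ⟨u, -, hi, h⟩
  refine vecMul_GL_ne_zero K (u := u) ?_ (funext fun j => h j (notMem_empty j))
  rintro rfl
  simp at hi

lemma undetermined_univ (K : GL (Fin n) (ZMod 2)) (i : Fin n) : Undetermined K.1 i univ :=
  ⟨Pi.single i 1, fun j hj => by simp [hj.ne], by simp, fun j hj => absurd (mem_univ j) hj⟩

lemma undeterminedCount_zero (K : GL (Fin n) (ZMod 2)) (i : Fin n) :
    undeterminedCount K i 0 = 0 := by
  simp [undeterminedCount, filter_singleton, not_undetermined_empty]

lemma determinedCount_self (K : GL (Fin n) (ZMod 2)) (i : Fin n) :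
    determinedCount K i n = 0 := by
  have : powersetCard n (univ : Finset (Fin n)) = {univ} := by
    simpa using powersetCard_self (univ : Finset (Fin n))
  simp [determinedCount, this, filter_singleton, undetermined_univ]

lemma sum_undeterminedCount_le (i : Fin n) (e : ℕ) :
    (∑ K : GL (Fin n) (ZMod 2), undeterminedCount K i e) * 2 ^ ((i : ℕ) + 1) ≤
      Fintype.card (GL (Fin n) (ZMod 2)) * 2 ^ e * n.choose e := by
  classical
  simp only [undeterminedCount, card_filter]
  rw [sum_comm, sum_mul]
  calc _ ≤ ∑ E ∈ powersetCard e (univ : Finset (Fin n)),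
        Fintype.card (GL (Fin n) (ZMod 2)) * 2 ^ e := by
        refine sum_le_sum fun E hE => ?_
        have := card_undetermined_le i E
        rw [(mem_powersetCard.1 hE).2, card_filter] at this
        convert this
    _ = _ := by
        rw [sum_const, card_powersetCard, card_univ, Fintype.card_fin, smul_eq_mul]
        ring

lemma sum_determinedCount_le (i : Fin n) (e : ℕ) :
    (∑ K : GL (Fin n) (ZMod 2), determinedCount K i e) * 2 ^ e ≤
      Fintype.card (GL (Fin n) (ZMod 2)) * 2 ^ (i : ℕ) * n.choose e := by
  classical
  simp only [determinedCount, card_filter]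
  rw [sum_comm, sum_mul]
  calc _ ≤ ∑ E ∈ powersetCard e (univ : Finset (Fin n)),
        Fintype.card (GL (Fin n) (ZMod 2)) * 2 ^ (i : ℕ) := by
        refine sum_le_sum fun E hE => ?_
        have := card_not_undetermined_le i E
        rw [(mem_powersetCard.1 hE).2, card_filter] at this
        convert this
    _ = _ := by
        rw [sum_const, card_powersetCard, card_univ, Fintype.card_fin, smul_eq_mul]
        ring

open Classical in
/-- All but a fraction `2 * (n + 1) / n ^ 3` of the kernels have sharp counts. -/
lemma card_not_sharpCounts_le (n : ℕ) :
    #{K : GL (Fin n) (ZMod 2) | ¬ SharpCounts n (undeterminedCount K) (determinedCount K)} *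
      (n : ℝ) ^ 4 ≤ 2 * n * (n + 1) * Fintype.card (GL (Fin n) (ZMod 2)) := by
  let a (K : GL (Fin n) (ZMod 2)) (i : Fin n) (e : ℕ) : ℝ :=
    undeterminedCount K i e * 2 ^ ((i : ℕ) + 1) / (2 ^ e * n.choose e)
  let b (K : GL (Fin n) (ZMod 2)) (i : Fin n) (e : ℕ) : ℝ :=
    determinedCount K i e * 2 ^ e / (2 ^ (i : ℕ) * n.choose e)
  -- Each ratio `a`, `b` averages to at most `1` over the kernels. Being nonnegative, all are at
  -- most `n ^ 4` as soon as their sum is.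
  let X (K : GL (Fin n) (ZMod 2)) : ℝ := ∑ i, ∑ e ∈ range (n + 1), (a K i e + b K i e)
  have ha0 : ∀ K i e, 0 ≤ a K i e := fun K i e => by positivity
  have hb0 : ∀ K i e, 0 ≤ b K i e := fun K i e => by positivity
  have hX0 : ∀ K, 0 ≤ X K := fun K =>
    sum_nonneg fun i _ => sum_nonneg fun e _ => add_nonneg (ha0 ..) (hb0 ..)
  have hle : ∀ K i e, e ≤ n → a K i e + b K i e ≤ X K := by
    intro K i e he
    refine (single_le_sum (f := fun e => a K i e + b K i e)
      (fun e _ => add_nonneg (ha0 ..) (hb0 ..)) (mem_range.2 (Nat.lt_succ_of_le he))).trans ?_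
    exact single_le_sum (f := fun i => ∑ e ∈ range (n + 1), (a K i e + b K i e))
      (fun i _ => sum_nonneg fun e _ => add_nonneg (ha0 ..) (hb0 ..)) (mem_univ i)
  have hchoose : ∀ e, e ≤ n → (0 : ℝ) < n.choose e := fun e he => by
    exact_mod_cast Nat.choose_pos he
  have hbad : ∀ K : GL (Fin n) (ZMod 2),
      ¬ SharpCounts n (undeterminedCount K) (determinedCount K) → (n : ℝ) ^ 4 ≤ X K := by
    intro K hK
    by_contra! hlt
    refine hK ⟨undeterminedCount_add_determinedCount K, undeterminedCount_zero K,
      determinedCount_self K, fun i e he => ?_, fun i e he => ?_⟩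
    · have hc := hchoose e he
      have h1 : a K i e ≤ (n : ℝ) ^ 4 := by linarith [hle K i e he, hb0 K i e]
      rw [div_le_iff₀ (by positivity), ← mul_assoc] at h1
      exact_mod_cast h1
    · have hc := hchoose e he
      have h1 : b K i e ≤ (n : ℝ) ^ 4 := by linarith [hle K i e he, ha0 K i e]
      rw [div_le_iff₀ (by positivity), ← mul_assoc] at h1
      exact_mod_cast h1
  have hsum : ∑ K, X K ≤ ∑ i : Fin n, ∑ e ∈ range (n + 1),
      2 * (Fintype.card (GL (Fin n) (ZMod 2)) : ℝ) := by
    rw [sum_comm]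
    refine sum_le_sum fun i _ => ?_
    rw [sum_comm]
    refine sum_le_sum fun e he => ?_
    have hc := hchoose e (Nat.lt_succ_iff.1 (mem_range.1 he))
    rw [sum_add_distrib, two_mul]
    refine add_le_add ?_ ?_
    · rw [← sum_div, ← sum_mul, div_le_iff₀ (by positivity), ← mul_assoc]
      exact_mod_cast sum_undeterminedCount_le i e
    · rw [← sum_div, ← sum_mul, div_le_iff₀ (by positivity), ← mul_assoc]
      exact_mod_cast sum_determinedCount_le i e
  rw [← nsmul_eq_mul, ← sum_const]
  calc _ ≤ ∑ K : GL (Fin n) (ZMod 2) with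
        ¬ SharpCounts n (undeterminedCount K) (determinedCount K), X K :=
        sum_le_sum fun K hK => hbad K (mem_filter.1 hK).2
    _ ≤ ∑ K, X K := sum_le_sum_of_subset_of_nonneg (subset_univ _) fun K _ _ => hX0 K
    _ ≤ _ := hsum
    _ = _ := by
        simp only [sum_const, card_univ, Fintype.card_fin, card_range, nsmul_eq_mul]
        push_cast
        ring

lemma one_sub_le_uniformProb_sharpCounts (hn : 1 ≤ n) :
    1 - 2 * ((n : ℝ) + 1) / n ^ 3 ≤ uniformProb {K : GL (Fin n) (ZMod 2) |
      SharpCounts n (undeterminedCount K) (determinedCount K)} := by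
  classical
  have hn0 : (0 : ℝ) < n := by exact_mod_cast hn
  have h1 := card_not_sharpCounts_le n
  have h2 := card_filter_add_card_filter_not (s := (univ : Finset (GL (Fin n) (ZMod 2))))
    (fun K => SharpCounts n (undeterminedCount K) (determinedCount K))
  have hG : (0 : ℝ) < Fintype.card (GL (Fin n) (ZMod 2)) := by exact_mod_cast Fintype.card_pos
  have h3 : ({K : GL (Fin n) (ZMod 2) |
      SharpCounts n (undeterminedCount K) (determinedCount K)}).ncard =
      #{K : GL (Fin n) (ZMod 2) | SharpCounts n (undeterminedCount K) (determinedCount K)} := by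
    rw [← Set.ncard_coe_finset]
    simp
  rw [uniformProb, h3, Nat.card_eq_fintype_card, le_div_iff₀ hG, sub_mul, one_mul]
  have h5 : (#{K : GL (Fin n) (ZMod 2) |
      SharpCounts n (undeterminedCount K) (determinedCount K)} : ℝ) +
      #{K : GL (Fin n) (ZMod 2) |
        ¬ SharpCounts n (undeterminedCount K) (determinedCount K)} =
      Fintype.card (GL (Fin n) (ZMod 2)) := by
    rw [← card_univ]
    exact_mod_cast h2
  have h4 : (#{K : GL (Fin n) (ZMod 2) |
      ¬ SharpCounts n (undeterminedCount K) (determinedCount K)} : ℝ) ≤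
      2 * ((n : ℝ) + 1) / n ^ 3 * Fintype.card (GL (Fin n) (ZMod 2)) := by
    rw [div_mul_eq_mul_div, le_div_iff₀ (by positivity)]
    refine le_of_mul_le_mul_right ?_ hn0
    linarith
  linarith

/-- The full pattern leaves the bit undetermined, the empty one determines it, and both have
positive weight. Strictness makes `lam` positive, as the logarithm requires. -/
lemma f_mem_Ioo (K : GL (Fin n) (ZMod 2)) (i : Fin n) {z : ℝ} (hz : z ∈ Set.Ioo (0 : ℝ) 1) :
    f K i z ∈ Set.Ioo (0 : ℝ) 1 := by
  have pos : ∀ (N : ℕ → ℕ) (e : ℕ), e ≤ n → 0 < N e → 0 < binomialSum n N z := by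
    intro N e he hN
    have h1 : 0 < z := hz.1
    have h2 : 0 < 1 - z := sub_pos.2 hz.2
    exact sum_pos' (fun e _ => by positivity) ⟨e, mem_range.2 (by omega), by positivity⟩
  have hadd := binomialSum_add (undeterminedCount_add_determinedCount K i) z
  have hlast := undeterminedCount_add_determinedCount K i n
  have hzero := undeterminedCount_add_determinedCount K i 0
  rw [determinedCount_self, Nat.choose_self] at hlast
  rw [undeterminedCount_zero, Nat.choose_zero_right] at hzero
  have h1 := pos (undeterminedCount K i) n le_rfl (by omega)
  have h2 := pos (determinedCount K i) 0 (Nat.zero_le n) (by omega)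
  rw [f_eq_binomialSum K i hz]
  exact ⟨h1, by linarith⟩

lemma lam_pos (hn : 0 < n) (α : ℝ) (K : GL (Fin n) (ZMod 2)) {z : ℝ}
    (hz : z ∈ Set.Ioo (0 : ℝ) 1) : 0 < lam α K z := by
  have : NeZero n := ⟨hn.ne'⟩
  refine div_pos (mul_pos (by positivity) ?_) (g_pos α hz)
  exact sum_pos (fun i _ => g_pos α (f_mem_Ioo K i hz)) univ_nonempty

end PolarKernel
end

/-! ### The main theorem. -/

theorem theorem4 (α : ℝ) (hα : α ∈ Set.Ioo (0 : ℝ) (1 / 16)) :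
    ∃ ℓ₁ : ℕ, ∀ ℓ : ℕ, ℓ₁ < ℓ →
      1 - 2 / (ℓ : ℝ) ≤
        PolarKernel.uniformProb {K : GL (Fin ℓ) (ZMod 2) |
          BddAbove (PolarKernel.lam α K '' Set.Ioo (0 : ℝ) 1) ∧
            Real.logb (ℓ : ℝ) (PolarKernel.lamSup α K) ≤ -(1 / 2) + 5 * α} := by
  open PolarKernel in
  obtain ⟨ℓ₁, h⟩ := Filter.eventually_atTop.1
    (eventually_sum_g_le hα.1 (by linarith [hα.2] : α ≤ 1))
  refine ⟨max ℓ₁ 2, fun ℓ hℓ => ?_⟩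
  have h2 : 2 < ℓ := (le_max_right _ _).trans_lt hℓ
  have h2' : (2 : ℝ) < ℓ := by exact_mod_cast h2
  have hℓ0 : (0 : ℝ) < ℓ := by linarith
  have hsharp := h ℓ ((le_max_left _ _).trans hℓ.le)
  have hprob : 1 - 2 / (ℓ : ℝ) ≤ 1 - 2 * ((ℓ : ℝ) + 1) / ℓ ^ 3 := by
    have : 2 * ((ℓ : ℝ) + 1) / ℓ ^ 3 ≤ 2 / ℓ := by
      rw [div_le_div_iff₀ (by positivity) hℓ0]
      have : (ℓ : ℝ) + 1 ≤ ℓ * ℓ := by nlinarith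
      calc 2 * ((ℓ : ℝ) + 1) * ℓ ≤ 2 * (ℓ * ℓ) * ℓ := by gcongr
        _ = 2 * ℓ ^ 3 := by ring
    linarith
  refine hprob.trans ((one_sub_le_uniformProb_sharpCounts (by omega)).trans ?_)
  refine div_le_div_of_nonneg_right ?_ (Nat.cast_nonneg _)
  refine Nat.cast_le.2 (Set.ncard_le_ncard (fun K hK => ?_) (Set.toFinite _))
  have hle : ∀ z ∈ Set.Ioo (0 : ℝ) 1, lam α K z ≤ (ℓ : ℝ) ^ (-(1 / 2) + 5 * α) := by
    intro z hz
    have h3 := hsharp _ _ hK z hz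
    simp only [← f_eq_binomialSum K _ hz] at h3
    rw [lam, div_le_iff₀ (g_pos α hz), one_div_mul_eq_div, div_le_iff₀ hℓ0]
    refine h3.trans_eq ?_
    have h4 : (ℓ : ℝ) ^ (1 / 2 + 5 * α) = (ℓ : ℝ) ^ (-(1 / 2) + 5 * α) * ℓ := by
      rw [← Real.rpow_add_one hℓ0.ne']
      ring_nf
    rw [h4]
    ring
  -- Boundedness is a separate claim because the real `sSup` of an unbounded set is `0`.
  have hbdd : BddAbove (lam α K '' Set.Ioo (0 : ℝ) 1) :=
    ⟨_, by rintro _ ⟨z, hz, rfl⟩; exact hle z hz⟩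
  have hhalf : (1 / 2 : ℝ) ∈ Set.Ioo (0 : ℝ) 1 := ⟨by norm_num, by norm_num⟩
  have hpos : 0 < lamSup α K :=
    (lam_pos (by omega) α K hhalf).trans_le (le_csSup hbdd ⟨_, hhalf, rfl⟩)
  refine ⟨hbdd, (Real.logb_le_iff_le_rpow (by linarith) hpos).2 ?_⟩
  refine csSup_le ⟨_, _, hhalf, rfl⟩ ?_
  rintro _ ⟨z, hz, rfl⟩
  exact hle z hz
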